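/- Let $u\in\mathbb C$ be a primitive fifth root of unity, so that $1+u+u^2+u^3+u^4=0$, and for integers $a,b,c,d$ write $\lfloor a,b,c,d\rfloor = au+bu^2+cu^3+du^4$. Let $S$ be a compact oriented piecewise linear surface, possibly with boundary. A link diagram $L$ in $S$ consists of a projection, that is, a finite union of closed curves in the interior of $S$ whose only (self-)intersections are finitely many transverse double points (crossings), with over/under information at every crossing. The faces of $L$ are the connected components of $S$ minus the projection; $L$ is well-placed if every face touches $\partial S$ in a connected (possibly empty) set. A state $\sigma$ colours each face white or black; it is forbidden if there is an edge such that the faces on both of its sides (possibly the same face) are black. Put $x_{\mathrm{white}}=1$, $x_{\mathrm{black}}=u^2+u^3$. View a crossing so that the overpass runs from northeast to southwest, and read the colours of the four adjacent faces anticlockwise starting from the east (0 for white, 1 for black); the weight of the crossing is $$0000\mapsto -u^2-u^3,\quad 0001,0100\mapsto -u^3,\quad 0010,1000\mapsto -u^2,\quad 0101\mapsto u,\quad 1010\mapsto u^4,$$ and $0$ for all other words. Define $$[L]_u=\sum_{\sigma\text{ not forbidden}}\ \prod_{f\text{ face}} x_{\sigma(f)}^{\chi_f}\prod_{p\text{ crossing}}\mathrm{weight}_p(\sigma),$$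 where $\chi_f$ is the Euler characteristic of $f$. Proposition. Let $L$ be a well-placed link diagram in $S$ and let $L^\star$ be its mirror image with respect to the surface (same projection, all crossings switched). Then $[L]_u$ can be written as $\lfloor a,b,c,d\rfloor$ for unique integers $a,b,c,d$; whenever $[L]_u=\lfloor a,b,c,d\rfloor$ with integers $a,b,c,d$, one has $[L^\star]_u=\lfloor d,c,b,a\rfloor$; that is, $[L^\star]_u=\overline{[L]_u}$. -/

import Mathlib

open scoped Manifold Topology ComplexConjugate

noncomputable section

universe w

namespace UInvariant

/-! ## Oriented piecewise linear surfaces -/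

/-- The plane. -/
abbrev Plane : Type := EuclideanSpace ℝ (Fin 2)

/-- The closed half plane `{v | 0 ≤ v 0}`, the local model of a surface with boundary. -/
abbrev HalfPlane : Type := EuclideanHalfSpace 2

/-- `f` is continuous on `s` and agrees, near each point of `s`, at each point with one of finitely
many affine maps of positive determinant.  A continuous function which locally selects its values
from finitely many affine functions is the same thing as a piecewise linear function. -/
def OrientedPLOn (f : HalfPlane → HalfPlane) (s : Set HalfPlane) : Prop :=
  ContinuousOn f s ∧
    ∀ x ∈ s, ∃ F : Set (Plane →ᵃ[ℝ] Plane), F.Finite ∧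
      (∀ A ∈ F, 0 < LinearMap.det A.linear) ∧
      ∀ᶠ y in 𝓝[s] x, ∃ A ∈ F, (f y).val = A y.val

/-- Orientation preserving piecewise linear maps form a pregroupoid on the half plane. -/
def orientedPLPregroupoid : Pregroupoid HalfPlane where
  property := OrientedPLOn
  comp := by
    rintro f g u v ⟨hfc, hf⟩ ⟨hgc, hg⟩ hu hv huv
    refine ⟨hgc.comp (hfc.mono Set.inter_subset_left) (fun x hx => hx.2), ?_⟩
    rintro x ⟨hxu, hxv⟩
    obtain ⟨F, hF, hFd, hFe⟩ := hf x hxu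
    obtain ⟨G, hG, hGd, hGe⟩ := hg (f x) hxv
    refine ⟨Set.image2 (fun B A => B.comp A) G F, hG.image2 _ hF, ?_, ?_⟩
    · rintro _ ⟨B, hB, A, hA, rfl⟩
      rw [AffineMap.comp_linear, LinearMap.det_comp]
      exact mul_pos (hGd B hB) (hFd A hA)
    · have h1 := hFe.filter_mono (nhdsWithin_mono x (Set.inter_subset_left (t := f ⁻¹' v)))
      have h2 : Filter.Tendsto f (𝓝[u ∩ f ⁻¹' v] x) (𝓝[v] (f x)) :=
        tendsto_nhdsWithin_iff.2 ⟨(hfc x hxu).mono Set.inter_subset_left,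
          Filter.eventually_of_mem self_mem_nhdsWithin fun y hy => hy.2⟩
      filter_upwards [h1, h2.eventually hGe] with y ⟨A, hA, hAy⟩ ⟨B, hB, hBy⟩
      refine ⟨_, Set.mem_image2_of_mem hB hA, ?_⟩
      rw [Function.comp_apply, hBy, hAy]
      rfl
  id_mem := by
    refine ⟨continuousOn_id, fun x _ => ⟨{AffineMap.id ℝ Plane}, Set.finite_singleton _, ?_, ?_⟩⟩
    · rintro A rfl
      simp
    · exact Filter.Eventually.of_forall fun y => ⟨_, rfl, rfl⟩
  locality := by
    intro f u hu h
    refine ⟨fun x hx => ?_, fun x hx => ?_⟩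
    · obtain ⟨v, hv, hxv, hc, -⟩ := h x hx
      exact (continuousWithinAt_inter (hv.mem_nhds hxv)).1 (hc x ⟨hx, hxv⟩)
    · obtain ⟨v, hv, hxv, -, hf⟩ := h x hx
      obtain ⟨F, hF, hFd, hFe⟩ := hf x ⟨hx, hxv⟩
      refine ⟨F, hF, hFd, ?_⟩
      rwa [Set.inter_comm, nhdsWithin_inter_of_mem (mem_nhdsWithin_of_mem_nhds (hv.mem_nhds hxv))] at hFe
  congr := by
    rintro f g u hu h ⟨hc, hf⟩
    refine ⟨hc.congr h, fun x hx => ?_⟩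
    obtain ⟨F, hF, hFd, hFe⟩ := hf x hx
    refine ⟨F, hF, hFd, ?_⟩
    filter_upwards [hFe, self_mem_nhdsWithin] with y ⟨A, hA, hy⟩ hyu
    exact ⟨A, hA, by rw [h y hyu, hy]⟩

/-- The groupoid of orientation preserving piecewise linear homeomorphisms between open subsets of
the half plane.  An oriented piecewise linear surface is a space with an atlas whose changes of
charts belong to it. -/
def orientedPL : StructureGroupoid HalfPlane := orientedPLPregroupoid.groupoid

/-- The Euler characteristic of a space, through singular homology with rational coefficients. -/
def eulerCharacteristic (X : Type w) [TopologicalSpace X] : ℤ :=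
  HomologicalComplex.homologyEulerChar
    (((AlgebraicTopology.singularChainComplexFunctor (ModuleCat.{w} ℚ)).obj
      (ModuleCat.of ℚ (ULift.{w} ℚ))).obj (TopCat.of X))

/-! ## Link projections and diagrams in a surface -/

/-- The centre `(1, 0)` of the model disk. -/
def diskCentre : HalfPlane := ⟨!₂[1, 0], by simp⟩

/-- The open unit disk around `(1, 0)`, which lies in the interior of the half plane. -/
def disk : Set HalfPlane := {v | (v.val 0 - 1) ^ 2 + v.val 1 ^ 2 < 1}

/-- The point of the half plane at the position `(x, y)` relative to the centre `(1, 0)`. -/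
def diskPoint (x y : ℝ) (hx : -1 ≤ x) : HalfPlane := ⟨!₂[1 + x, y], by simp; linarith⟩

section Surface

variable {S : Type*} [TopologicalSpace S] [ChartedSpace HalfPlane S]

/-- A coordinate disk of the oriented surface `S` around its interior point `p`. -/
structure DiskChart (p : S) where
  chart : OpenPartialHomeomorph S HalfPlane
  mem_maximalAtlas : chart ∈ orientedPL.maximalAtlas S
  mem_source : p ∈ chart.source
  apply_centre : chart p = diskCentre
  target_eq : chart.target = disk

namespace DiskChart

variable {p : S} (e : DiskChart p)

/-- The first coordinate relative to `p` (pointing east). -/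
def x (q : S) : ℝ := (e.chart q).val 0 - 1

/-- The second coordinate relative to `p` (pointing north). -/
def y (q : S) : ℝ := (e.chart q).val 1

/-- The point with the given coordinates relative to `p`. -/
def point (x y : ℝ) (hx : -1 ≤ x) : S := e.chart.symm (diskPoint x y hx)

/-- In these coordinates `T` is the east-west diameter of the disk. -/
def IsStraight (T : Set S) : Prop := ∀ q ∈ e.chart.source, q ∈ T ↔ e.y q = 0

/-- In these coordinates `T` consists of the two diagonal diameters of the disk. -/
def IsCross (T : Set S) : Prop := ∀ q ∈ e.chart.source, q ∈ T ↔ e.x q = e.y q ∨ e.x q = -e.y q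

lemma point_mem_source {x y : ℝ} (hx : -1 ≤ x) (h : x ^ 2 + y ^ 2 < 1) :
    e.point x y hx ∈ e.chart.source := by
  apply e.chart.map_target
  rw [e.target_eq]
  simpa [disk, diskPoint] using h

lemma chart_point {x y : ℝ} (hx : -1 ≤ x) (h : x ^ 2 + y ^ 2 < 1) :
    e.chart (e.point x y hx) = diskPoint x y hx := by
  apply e.chart.right_inv
  rw [e.target_eq]
  simpa [disk, diskPoint] using h

lemma x_point {x y : ℝ} (hx : -1 ≤ x) (h : x ^ 2 + y ^ 2 < 1) : e.x (e.point x y hx) = x := by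
  rw [DiskChart.x, e.chart_point hx h]
  simp [diskPoint]

lemma y_point {x y : ℝ} (hx : -1 ≤ x) (h : x ^ 2 + y ^ 2 < 1) : e.y (e.point x y hx) = y := by
  rw [DiskChart.y, e.chart_point hx h]
  simp [diskPoint]

lemma IsStraight.point_notMem {e : DiskChart p} {T : Set S} (he : e.IsStraight T) {x y : ℝ}
    (hx : -1 ≤ x) (h : x ^ 2 + y ^ 2 < 1) (hy : y ≠ 0) : e.point x y hx ∉ T := by
  rwa [he _ (e.point_mem_source hx h), e.y_point hx h]

lemma IsCross.point_notMem {e : DiskChart p} {T : Set S} (he : e.IsCross T) {x y : ℝ}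
    (hx : -1 ≤ x) (h : x ^ 2 + y ^ 2 < 1) (hxy : x ≠ y ∧ x ≠ -y) : e.point x y hx ∉ T := by
  rw [he _ (e.point_mem_source hx h), e.y_point hx h, e.x_point hx h]
  tauto

/-- The part of the disk where two linear functions of the coordinates are positive. -/
def sector (a b a' b' : ℝ) : Set S :=
  {q | q ∈ e.chart.source ∧ 0 < a * e.x q + b * e.y q ∧ 0 < a' * e.x q + b' * e.y q}

lemma isPreconnected_sector (a b a' b' : ℝ) : IsPreconnected (e.sector a b a' b') := by
  set V : Set HalfPlane := {v | v ∈ disk ∧ 0 < a * (v.val 0 - 1) + b * v.val 1 ∧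
    0 < a' * (v.val 0 - 1) + b' * v.val 1} with hV
  have hconv : Convex ℝ {v : Plane | (v 0 - 1) ^ 2 + v 1 ^ 2 < 1 ∧
      0 < a * (v 0 - 1) + b * v 1 ∧ 0 < a' * (v 0 - 1) + b' * v 1} := by
    rintro v ⟨h1, h2, h3⟩ w ⟨k1, k2, k3⟩ s t hs ht hst
    simp only [Set.mem_ofPred_eq, PiLp.add_apply, PiLp.smul_apply, smul_eq_mul]
    have e1 : s * v 0 + t * w 0 - 1 = s * (v 0 - 1) + t * (w 0 - 1) := by linear_combination hst
    rw [e1]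
    have pos : ∀ {α β : ℝ}, 0 < α → 0 < β → 0 < s * α + t * β := by
      intro α β hα hβ
      rcases hs.eq_or_lt with h | h
      · have : t = 1 := by linarith
        subst this; rw [← h]; linarith
      · exact add_pos_of_pos_of_nonneg (mul_pos h hα) (mul_nonneg ht hβ.le)
    refine ⟨?_, ?_, ?_⟩
    · have h5 := pos (sub_pos.2 h1) (sub_pos.2 k1)
      have h6 : 0 ≤ s * t * (((v 0 - 1) - (w 0 - 1)) ^ 2 + (v 1 - w 1) ^ 2) :=
        mul_nonneg (mul_nonneg hs ht) (add_nonneg (sq_nonneg _) (sq_nonneg _))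
      obtain rfl : t = 1 - s := by linarith
      nlinarith
    · have := pos h2 k2; linarith
    · have := pos h3 k3; linarith
  have hVc : IsPreconnected V := by
    have hi : Topology.IsInducing (Subtype.val : HalfPlane → Plane) := ⟨rfl⟩
    rw [← hi.isPreconnected_image]
    convert hconv.isPreconnected using 1
    ext v
    constructor
    · rintro ⟨w, hw, rfl⟩
      exact hw
    · intro hv
      refine ⟨⟨v, ?_⟩, hv, rfl⟩
      have := hv.1
      by_contra hneg
      push Not at hneg
      nlinarith [sq_nonneg (v 1)]
  have hsec : e.sector a b a' b' = e.chart.symm '' V := by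
    ext q
    constructor
    · rintro ⟨hq, h1, h2⟩
      refine ⟨e.chart q, ⟨?_, h1, h2⟩, e.chart.left_inv hq⟩
      rw [← e.target_eq]
      exact e.chart.map_source hq
    · rintro ⟨v, ⟨hv, h1, h2⟩, rfl⟩
      rw [← e.target_eq] at hv
      refine ⟨e.chart.map_target hv, ?_, ?_⟩
      · rw [DiskChart.x, DiskChart.y, e.chart.right_inv hv]; exact h1
      · rw [DiskChart.x, DiskChart.y, e.chart.right_inv hv]; exact h2
  rw [hsec]
  refine hVc.image _ (e.chart.symm.continuousOn.mono ?_)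
  rintro v ⟨hv, -⟩
  rw [e.chart.symm_source, e.target_eq]
  exact hv

end DiskChart

end Surface

/-- The projection of a link to the surface `S`: a closed subset which is a locally straight curve,
disjoint from the boundary of `S`, except at finitely many crossings, where two such strands
intersect transversely.  Equivalently (for compact `S`), the union of finitely many closed curves
all of whose (self-)intersections are transverse double points. -/
structure Projection (S : Type*) [TopologicalSpace S] [ChartedSpace HalfPlane S] where
  carrier : Set S
  isClosed_carrier : IsClosed carrier
  crossings : Finset S
  exists_isStraight : ∀ p ∈ carrier, p ∉ crossings → ∃ e : DiskChart p, e.IsStraight carrier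
  exists_isCross : ∀ p ∈ crossings, ∃ e : DiskChart p, e.IsCross carrier

/-- A link diagram (closed tangle) in `S`: a projection, with the indication at each crossing `p` of
one of its two strands, the overpass.  Only the germ of the set `overpass p` at `p` matters. -/
structure LinkDiagram (S : Type*) [TopologicalSpace S] [ChartedSpace HalfPlane S] extends
    Projection S where
  overpass : S → Set S
  overpass_spec : ∀ p ∈ crossings, ∀ e : DiskChart p, e.IsCross carrier →
    (∀ᶠ q in 𝓝 p, q ∈ overpass p ↔ e.x q = e.y q) ∨
    (∀ᶠ q in 𝓝 p, q ∈ overpass p ↔ e.x q = -e.y q)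

section Faces

variable {S : Type*} [TopologicalSpace S] [ChartedSpace HalfPlane S]

namespace Projection

variable (P : Projection S)

/-- The faces: connected components of the complement of the projection. -/
abbrev Face : Type _ := ConnectedComponents (P.carrierᶜ : Set S)

variable {P}

/-- The face containing a given point off the projection. -/
def faceOf (q : S) (hq : q ∉ P.carrier) : P.Face := ConnectedComponents.mk ⟨q, hq⟩

/-- A face, as a subset of the complement of the projection. -/
def Face.points (f : P.Face) : Set (P.carrierᶜ : Set S) := {q | ConnectedComponents.mk q = f}

/-- The Euler characteristic of a face. -/
def Face.euler (f : P.Face) : ℤ := eulerCharacteristic f.points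

lemma faces_subsingleton {A : Set S} (hA : IsPreconnected A) (hAP : A ⊆ P.carrierᶜ) :
    {f : P.Face | ∃ q : (P.carrierᶜ : Set S), q.val ∈ A ∧ ConnectedComponents.mk q = f}.Finite := by
  apply Set.Subsingleton.finite
  rintro _ ⟨q, hq, rfl⟩ _ ⟨r, hr, rfl⟩
  have hB : IsPreconnected (Subtype.val ⁻¹' A : Set (P.carrierᶜ : Set S)) := by
    rw [← Topology.IsInducing.subtypeVal.isPreconnected_image, Subtype.image_preimage_coe,
      Set.inter_eq_right.2 hAP]
    exact hA
  rw [ConnectedComponents.coe_eq_coe']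
  exact hB.subset_connectedComponent hr hq

lemma exists_nhds_finite_faces (p : S) : ∃ U ∈ 𝓝 p,
    {f : P.Face | ∃ q : (P.carrierᶜ : Set S), q.val ∈ U ∧
      ConnectedComponents.mk q = f}.Finite := by
  have : LocallyConnectedSpace HalfPlane := by
    have : LocallyPathConnectedSpace HalfPlane := inferInstance
    infer_instance
  have : LocallyConnectedSpace S := ChartedSpace.locallyConnectedSpace HalfPlane S
  by_cases hp : p ∈ P.carrier
  · by_cases hc : p ∈ P.crossings
    · obtain ⟨e, he⟩ := P.exists_isCross p hc
      refine ⟨e.chart.source, e.chart.open_source.mem_nhds e.mem_source, ?_⟩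
      have key : ∀ a b a' b' : ℝ, (e.sector a b a' b' ⊆ P.carrierᶜ) →
          {f : P.Face | ∃ q : (P.carrierᶜ : Set S), q.val ∈ e.sector a b a' b' ∧
            ConnectedComponents.mk q = f}.Finite :=
        fun a b a' b' h => faces_subsingleton (e.isPreconnected_sector a b a' b') h
      refine ((((key 1 1 1 (-1) ?_).union (key 1 1 (-1) 1 ?_)).union
        (key (-1) (-1) 1 (-1) ?_)).union (key (-1) (-1) (-1) 1 ?_)).subset ?_
      iterate 4
        rintro q ⟨hq, h1, h2⟩
        rw [Set.mem_compl_iff, he q hq]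
        rintro (h | h) <;> linarith
      rintro f ⟨q, hq, rfl⟩
      have hq' : ¬ _ := fun h => q.2 ((he q.val hq).2 h)
      push Not at hq'
      rcases lt_or_gt_of_ne hq'.1 with h | h <;> rcases lt_or_gt_of_ne hq'.2 with k | k
      · exact Or.inr ⟨q, ⟨hq, by linarith, by linarith⟩, rfl⟩
      · exact Or.inl (Or.inl (Or.inr ⟨q, ⟨hq, by linarith, by linarith⟩, rfl⟩))
      · exact Or.inl (Or.inr ⟨q, ⟨hq, by linarith, by linarith⟩, rfl⟩)
      · exact Or.inl (Or.inl (Or.inl ⟨q, ⟨hq, by linarith, by linarith⟩, rfl⟩))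
    · obtain ⟨e, he⟩ := P.exists_isStraight p hp hc
      refine ⟨e.chart.source, e.chart.open_source.mem_nhds e.mem_source, ?_⟩
      have key : ∀ a b a' b' : ℝ, (e.sector a b a' b' ⊆ P.carrierᶜ) →
          {f : P.Face | ∃ q : (P.carrierᶜ : Set S), q.val ∈ e.sector a b a' b' ∧
            ConnectedComponents.mk q = f}.Finite :=
        fun a b a' b' h => faces_subsingleton (e.isPreconnected_sector a b a' b') h
      refine ((key 0 1 0 1 ?_).union (key 0 (-1) 0 (-1) ?_)).subset ?_
      iterate 2
        rintro q ⟨hq, h1, h2⟩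
        rw [Set.mem_compl_iff, he q hq]
        intro h
        linarith
      rintro f ⟨q, hq, rfl⟩
      have hq' : e.y q ≠ 0 := fun h => q.2 ((he q.val hq).2 h)
      rcases lt_or_gt_of_ne hq' with h | h
      · exact Or.inr ⟨q, ⟨hq, by linarith, by linarith⟩, rfl⟩
      · exact Or.inl ⟨q, ⟨hq, by linarith, by linarith⟩, rfl⟩
  · refine ⟨connectedComponentIn P.carrierᶜ p,
      P.isClosed_carrier.isOpen_compl.connectedComponentIn.mem_nhds (mem_connectedComponentIn hp),
      faces_subsingleton isPreconnected_connectedComponentIn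
        (connectedComponentIn_subset _ _)⟩

instance [CompactSpace S] : Finite P.Face := by
  choose U hU hfin using exists_nhds_finite_faces (P := P)
  obtain ⟨t, ht⟩ := CompactSpace.elim_nhds_subcover U hU
  have : (Set.univ : Set P.Face).Finite := by
    refine (t.finite_toSet.biUnion fun p _ => hfin p).subset ?_
    rintro f -
    obtain ⟨q, rfl⟩ := ConnectedComponents.surjective_coe f
    have hq : q.val ∈ ⋃ x ∈ t, U x := by rw [ht]; trivial
    simp only [Set.mem_iUnion] at hq
    obtain ⟨p, hp, hqp⟩ := hq
    exact Set.mem_biUnion hp ⟨q, hqp, rfl⟩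
  exact Set.finite_univ_iff.1 this

instance [CompactSpace S] : Fintype P.Face := Fintype.ofFinite _

variable (P)

/-- Every face touches the boundary of the surface in a connected (possibly empty) set. -/
def WellPlaced : Prop :=
  ∀ f : P.Face, IsPreconnected (closure (Subtype.val '' f.points) ∩ (𝓡∂ 2).boundary S)

/-! ## States and their values -/

end Projection

/-- The two symbols. -/
inductive Colour
  | white
  | black

instance : Finite Colour := Finite.of_surjective (fun b : Bool => if b then Colour.black else .white)
  (by rintro (_ | _); exacts [⟨false, rfl⟩, ⟨true, rfl⟩])

namespace Projection

variable (P : Projection S)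

/-- A state assigns a symbol to each face. -/
abbrev State : Type _ := P.Face → Colour

instance [CompactSpace S] : Fintype P.State := Fintype.ofFinite _

variable {P}

/-- The face on the north side of an edge, seen in a straight chart. -/
def northFace {p : S} {e : DiskChart p} (he : e.IsStraight P.carrier) : P.Face :=
  faceOf (e.point 0 (1 / 2) (by norm_num)) (he.point_notMem _ (by norm_num) (by norm_num))

/-- The face on the south side of an edge, seen in a straight chart. -/
def southFace {p : S} {e : DiskChart p} (he : e.IsStraight P.carrier) : P.Face :=
  faceOf (e.point 0 (-1 / 2) (by norm_num)) (he.point_notMem _ (by norm_num) (by norm_num))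

/-- A state is forbidden if somewhere along an edge the faces on both sides are black. -/
def State.Forbidden (σ : P.State) : Prop :=
  ∃ p ∈ P.carrier, p ∉ P.crossings ∧ ∃ (e : DiskChart p) (he : e.IsStraight P.carrier),
    σ (northFace he) = .black ∧ σ (southFace he) = .black

/-- The faces in the four corners of a crossing, anticlockwise starting from the east. -/
def cornerFace {p : S} {e : DiskChart p} (he : e.IsCross P.carrier) : Fin 4 → P.Face :=
  ![faceOf (e.point (1 / 2) 0 (by norm_num)) (he.point_notMem _ (by norm_num) (by norm_num)),
    faceOf (e.point 0 (1 / 2) (by norm_num)) (he.point_notMem _ (by norm_num) (by norm_num)),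
    faceOf (e.point (-1 / 2) 0 (by norm_num)) (he.point_notMem _ (by norm_num) (by norm_num)),
    faceOf (e.point 0 (-1 / 2) (by norm_num)) (he.point_notMem _ (by norm_num) (by norm_num))]

end Projection

/-- The value of the variable of a crossing whose overpass runs from northeast to southwest and
whose adjacent faces have the given symbols, anticlockwise starting from the east. -/
def crossingVariable (u : ℂ) : Colour → Colour → Colour → Colour → ℂ
  | .white, .white, .white, .white => -u ^ 2 - u ^ 3
  | .white, .white, .white, .black => -u ^ 3
  | .white, .black, .white, .white => -u ^ 3
  | .white, .white, .black, .white => -u ^ 2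
  | .black, .white, .white, .white => -u ^ 2
  | .white, .black, .white, .black => u
  | .black, .white, .black, .white => u ^ 4
  | _, _, _, _ => 0

/-- The value of the variable of a face with the given symbol. -/
def faceVariable (u : ℂ) : Colour → ℂ
  | .white => 1
  | .black => u ^ 2 + u ^ 3

namespace LinkDiagram

variable (L : LinkDiagram S)

open Classical in
/-- The contribution of a crossing to the value of a state.  The crossing is viewed in local
coordinates in which the two strands are the diagonals.  If the overpass runs from northwest to
southeast, the picture is first turned by a quarter turn, which brings the northern corner to the
east. -/
def crossingValue (u : ℂ) (σ : L.State) (p : L.crossings) : ℂ :=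
  let e := (L.exists_isCross p.1 p.2).choose
  let he : e.IsCross L.carrier := (L.exists_isCross p.1 p.2).choose_spec
  let c : Fin 4 → Colour := fun i => σ (Projection.cornerFace he i)
  if ∀ᶠ q in 𝓝 p.1, q ∈ L.overpass p.1 ↔ e.x q = e.y q then
    crossingVariable u (c 0) (c 1) (c 2) (c 3)
  else
    crossingVariable u (c 1) (c 2) (c 3) (c 0)

open Classical in
/-- The value of a state. -/
def stateValue [CompactSpace S] (u : ℂ) (σ : L.State) : ℂ :=
  if σ.Forbidden then 0
  else (∏ f : L.Face, faceVariable u (σ f) ^ f.euler) * ∏ p : L.crossings, L.crossingValue u σ p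

/-- The state sum `[L]_u`. -/
def uValue [CompactSpace S] (u : ℂ) : ℂ := ∑ σ : L.State, L.stateValue u σ

/-- `L'` is the mirror image of `L` with respect to the surface: it has the same projection, and at
every crossing the overpass of `L'` is the strand which is not the overpass of `L`. -/
def IsMirrorImage (L L' : LinkDiagram S) : Prop :=
  L'.toProjection = L.toProjection ∧
    ∀ p ∈ L.crossings, ∀ᶠ q in 𝓝[≠] p, q ∈ L.carrier → (q ∈ L'.overpass p ↔ q ∉ L.overpass p)

end LinkDiagram

end Faces

/-- `⌊a, b, c, d⌋` -/
def bracket (u : ℂ) (a b c d : ℤ) : ℂ := a * u + b * u ^ 2 + c * u ^ 3 + d * u ^ 4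

end UInvariant

end

/-! Complex conjugation sends `u` to `u ^ 4`, so it reverses the coefficients of a bracket; it
remains to see that mirroring conjugates the state sum. This holds state by state. A diagram and its
mirror image have the same faces, states and forbidden states, and the face variables are real
because `u ^ 2` and `u ^ 3` are conjugate. At a crossing, exchanging the strands amounts to a
quarter turn of the four colours, and a quarter turn conjugates the weight
(`conj_crossingVariable`). The topological input is `overpass_iff`: mirroring does exchange the two
strands in a given chart.

Existence of the coefficients holds because every factor of the state sum lies in `ℤ[u]`; uniqueness
is the linear independence of `u, u², u³, u⁴`. -/

namespace UInvariant

/-! ### Arithmetic and conjugation in `ℤ[u]` -/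

section FifthRoot

variable {u : ℂ}

lemma one_add_pow_eq_zero (hu : IsPrimitiveRoot u 5) : 1 + u + u ^ 2 + u ^ 3 + u ^ 4 = 0 := by
  have h := hu.geom_sum_eq_zero (by norm_num)
  simpa [Finset.sum_range_succ] using h

lemma conj_eq_pow_four (hu : IsPrimitiveRoot u 5) : conj u = u ^ 4 := by
  rw [← Complex.inv_eq_conj (hu.norm'_eq_one (by norm_num))]
  refine inv_eq_of_mul_eq_one_right ?_
  linear_combination hu.pow_eq_one

lemma conj_pow_two (hu : IsPrimitiveRoot u 5) : conj u ^ 2 = u ^ 3 := by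
  rw [conj_eq_pow_four hu]
  linear_combination u ^ 3 * hu.pow_eq_one

lemma conj_pow_three (hu : IsPrimitiveRoot u 5) : conj u ^ 3 = u ^ 2 := by
  rw [conj_eq_pow_four hu]
  linear_combination (u ^ 7 + u ^ 2) * hu.pow_eq_one

lemma conj_pow_four (hu : IsPrimitiveRoot u 5) : conj u ^ 4 = u := by
  rw [conj_eq_pow_four hu]
  linear_combination (u ^ 11 + u ^ 6 + u) * hu.pow_eq_one

lemma conj_bracket (hu : IsPrimitiveRoot u 5) (a b c d : ℤ) :
    conj (bracket u a b c d) = bracket u d c b a := by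
  simp only [bracket, map_add, map_mul, map_pow, map_intCast, conj_pow_two hu, conj_pow_three hu,
    conj_pow_four hu]
  rw [conj_eq_pow_four hu]
  ring

lemma conj_faceVariable (hu : IsPrimitiveRoot u 5) (c : Colour) :
    conj (faceVariable u c) = faceVariable u c := by
  cases c
  · simp [faceVariable]
  · simp only [faceVariable, map_add, map_pow, conj_pow_two hu, conj_pow_three hu]
    ring

/-- Turning a crossing by a quarter turn conjugates its variable. -/
lemma conj_crossingVariable (hu : IsPrimitiveRoot u 5) (c₀ c₁ c₂ c₃ : Colour) :
    conj (crossingVariable u c₀ c₁ c₂ c₃) = crossingVariable u c₁ c₂ c₃ c₀ := by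
  have h2 := conj_pow_two hu
  have h3 := conj_pow_three hu
  have h4 := conj_pow_four hu
  have h1 := conj_eq_pow_four hu
  cases c₀ <;> cases c₁ <;> cases c₂ <;> cases c₃ <;>
    simp only [crossingVariable, map_sub, map_neg, map_pow, map_zero, h2, h3, h4]
  · ring
  · exact h1

/-- Crossing variables are invariant under half turns. -/
lemma crossingVariable_half_turn (u : ℂ) (c₀ c₁ c₂ c₃ : Colour) :
    crossingVariable u c₂ c₃ c₀ c₁ = crossingVariable u c₀ c₁ c₂ c₃ := by
  cases c₀ <;> cases c₁ <;> cases c₂ <;> cases c₃ <;> rfl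

/-- The ring `ℤ[u]`, consisting of the values of the bracket. -/
def bracketSubring (hu : IsPrimitiveRoot u 5) : Subring ℂ where
  carrier := {z | ∃ a b c d : ℤ, z = bracket u a b c d}
  zero_mem' := ⟨0, 0, 0, 0, by simp [bracket]⟩
  one_mem' := ⟨-1, -1, -1, -1, by
    simp only [bracket]; push_cast; linear_combination one_add_pow_eq_zero hu⟩
  add_mem' := by
    rintro _ _ ⟨a, b, c, d, rfl⟩ ⟨a', b', c', d', rfl⟩
    exact ⟨a + a', b + b', c + c', d + d', by simp only [bracket]; push_cast; ring⟩
  neg_mem' := by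
    rintro _ ⟨a, b, c, d, rfl⟩
    exact ⟨-a, -b, -c, -d, by simp only [bracket]; push_cast; ring⟩
  mul_mem' := by
    rintro _ _ ⟨a, b, c, d, rfl⟩ ⟨a', b', c', d', rfl⟩
    -- Exponents are reduced modulo 5. The coefficient of `u ^ 5 = 1` is subtracted from all four
    -- entries, since `1 = -u - u² - u³ - u⁴`.
    refine ⟨b * d' + c * c' + d * b' - (a * d' + b * c' + c * b' + d * a'),
      a * a' + c * d' + d * c' - (a * d' + b * c' + c * b' + d * a'),
      a * b' + b * a' + d * d' - (a * d' + b * c' + c * b' + d * a'),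
      a * c' + b * b' + c * a' - (a * d' + b * c' + c * b' + d * a'), ?_⟩
    simp only [bracket]
    push_cast
    linear_combination (a * d' + b * c' + c * b' + d * a' : ℂ) * one_add_pow_eq_zero hu +
      ((a * d' + b * c' + c * b' + d * a') + (b * d' + c * c' + d * b') * u +
        (c * d' + d * c') * u ^ 2 + d * d' * u ^ 3 : ℂ) * hu.pow_eq_one

lemma self_mem_bracketSubring (hu : IsPrimitiveRoot u 5) : u ∈ bracketSubring hu :=
  ⟨1, 0, 0, 0, by simp [bracket]⟩

/-- Euler characteristics may be negative, so the black variable has to be a unit of `ℤ[u]`: the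
product of `u² + u³` and `u + u⁴` is `u + u² + u³ + u⁴ = -1`. -/
lemma faceVariable_zpow_mem (hu : IsPrimitiveRoot u 5) (c : Colour) (n : ℤ) :
    faceVariable u c ^ n ∈ bracketSubring hu := by
  have hU := self_mem_bracketSubring hu
  cases c
  · simp [faceVariable, one_mem]
  · have hinv : (u ^ 2 + u ^ 3)⁻¹ = -(u + u ^ 4) := by
      refine inv_eq_of_mul_eq_one_right ?_
      linear_combination -one_add_pow_eq_zero hu - (u + u ^ 2) * hu.pow_eq_one
    rcases n with n | n
    · rw [faceVariable, Int.ofNat_eq_natCast, zpow_natCast]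
      exact pow_mem (add_mem (pow_mem hU 2) (pow_mem hU 3)) n
    · rw [faceVariable, zpow_negSucc, ← inv_pow, hinv]
      exact pow_mem (neg_mem (add_mem hU (pow_mem hU 4))) _

lemma crossingVariable_mem (hu : IsPrimitiveRoot u 5) (c₀ c₁ c₂ c₃ : Colour) :
    crossingVariable u c₀ c₁ c₂ c₃ ∈ bracketSubring hu := by
  have hU := self_mem_bracketSubring hu
  cases c₀ <;> cases c₁ <;> cases c₂ <;> cases c₃ <;> simp only [crossingVariable]
  all_goals first
    | exact zero_mem _
    | exact hU
    | exact pow_mem hU _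
    | exact neg_mem (pow_mem hU _)
    | exact sub_mem (neg_mem (pow_mem hU _)) (pow_mem hU _)

/-- The powers `u, u², u³, u⁴` are linearly independent over the integers. -/
lemma bracket_injective (hu : IsPrimitiveRoot u 5) {v w : Fin 4 → ℤ}
    (h : bracket u (v 0) (v 1) (v 2) (v 3) = bracket u (w 0) (w 1) (w 2) (w 3)) : v = w := by
  have h0 : u ≠ 0 := hu.ne_zero (by norm_num)
  -- The degree is `φ(5) = 4`, so `1, u, u², u³` are independent over `ℚ`; multiplying by `u` turns
  -- a relation between these into one between brackets.
  have hdeg : (minpoly ℚ u).natDegree = 4 := by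
    rw [← Polynomial.cyclotomic_eq_minpoly_rat hu (by norm_num), Polynomial.natDegree_cyclotomic]
    decide
  have hli := linearIndependent_pow (K := ℚ) u
  rw [hdeg] at hli
  have hz := Fintype.linearIndependent_iff.1 hli (fun i => ((v i - w i : ℤ) : ℚ)) (by
    apply mul_left_cancel₀ h0
    simp only [bracket] at h
    simp only [Fin.sum_univ_four, Algebra.smul_def, map_intCast]
    push_cast
    simp only [Fin.val_zero, Fin.val_one, Fin.val_two,
      show ((3 : Fin 4) : ℕ) = 3 from rfl]
    linear_combination h)
  funext i
  have := hz i
  rw [Int.cast_eq_zero] at this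
  omega

end FifthRoot

/-! ### Mirror images and the state sum -/

section Diagram

variable {S : Type*} [TopologicalSpace S] [ChartedSpace HalfPlane S]

/-- Every neighbourhood of the centre of a disk chart meets both diagonals off the centre. -/
lemma DiskChart.frequently_diagonal {p : S} (e : DiskChart p) (s : ℝ) (hs : s ^ 2 = 1) :
    ∃ᶠ q in 𝓝[≠] p, q ∈ e.chart.source ∧ e.x q = s * e.y q := by
  -- The diagonal is parametrised by its second coordinate. The `max` keeps `g t` in the half plane
  -- for every real `t`; it has no effect near `0`.
  set g : ℝ → HalfPlane := fun t => ⟨!₂[1 + max (s * t) (-1), t], by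
    simp only [Fin.isValue, Matrix.cons_val_zero]
    linarith [le_max_right (s * t) (-1)]⟩ with hg
  have hgc : Continuous g := by
    apply Continuous.subtype_mk
    fun_prop
  have hg0 : g 0 = diskCentre := by
    apply Subtype.ext
    ext i
    fin_cases i <;> simp [hg, diskCentre]
  have htend : Filter.Tendsto (fun t => e.chart.symm (g t)) (𝓝 0) (𝓝 p) := by
    have h1 : Filter.Tendsto g (𝓝 0) (𝓝 (e.chart p)) := by
      rw [e.apply_centre, ← hg0]
      exact hgc.tendsto 0
    exact (e.chart.tendsto_symm e.mem_source).comp h1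
  have hsmall : ∀ᶠ t : ℝ in 𝓝[≠] 0, e.chart.symm (g t) ≠ p ∧
      e.chart.symm (g t) ∈ e.chart.source ∧
      e.x (e.chart.symm (g t)) = s * e.y (e.chart.symm (g t)) := by
    have hI : ∀ᶠ t : ℝ in 𝓝[≠] 0, t ∈ Set.Ioo (-(1 / 2) : ℝ) (1 / 2) :=
      nhdsWithin_le_nhds (Ioo_mem_nhds (by norm_num) (by norm_num))
    filter_upwards [hI, self_mem_nhdsWithin] with t ht ht0
    have hst : (s * t) ^ 2 = t ^ 2 := by rw [mul_pow, hs, one_mul]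
    have ht2 : t ^ 2 < 1 / 4 := by nlinarith [ht.1, ht.2]
    have hx : -1 ≤ s * t := by nlinarith
    have hgt : g t = diskPoint (s * t) t hx := by
      simp only [hg, diskPoint, max_eq_left hx]
    have hlt : (s * t) ^ 2 + t ^ 2 < 1 := by linarith
    rw [hgt]
    change e.point (s * t) t hx ≠ p ∧ e.point (s * t) t hx ∈ _ ∧
      e.x (e.point (s * t) t hx) = s * e.y (e.point (s * t) t hx)
    refine ⟨fun hp => ht0 ?_, e.point_mem_source hx hlt, by
      rw [e.x_point hx hlt, e.y_point hx hlt]⟩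
    -- The second coordinate is `t ≠ 0` at this point and `0` at `p`.
    have hy := e.y_point hx hlt
    rw [hp, DiskChart.y, e.apply_centre] at hy
    simpa [diskCentre] using hy.symm
  have hne : Filter.Tendsto (fun t => e.chart.symm (g t)) (𝓝[≠] 0) (𝓝[≠] p) :=
    tendsto_nhdsWithin_iff.2 ⟨htend.mono_left nhdsWithin_le_nhds, hsmall.mono fun t ht => ht.1⟩
  exact hne.frequently (hsmall.mono fun t ht => ht.2).frequently

namespace LinkDiagram

/-- At a crossing, a diagram and its mirror image do not have the same overpass. -/
lemma IsMirrorImage.not_same_overpass {L L' : LinkDiagram S} (h : L.IsMirrorImage L') {p : S}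
    (hp : p ∈ L.crossings) {e : DiskChart p} (he : e.IsCross L.carrier) {s : ℝ}
    (hs : s = 1 ∨ s = -1) (hL : ∀ᶠ q in 𝓝 p, q ∈ L.overpass p ↔ e.x q = s * e.y q) :
    ¬ ∀ᶠ q in 𝓝 p, q ∈ L'.overpass p ↔ e.x q = s * e.y q := by
  intro hL'
  have hs2 : s ^ 2 = 1 := by rcases hs with rfl | rfl <;> norm_num
  obtain ⟨q, ⟨hq, hxy⟩, hm, h1, h2⟩ := ((e.frequently_diagonal s hs2).and_eventually
    ((h.2 p hp).and ((hL.filter_mono nhdsWithin_le_nhds).and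
      (hL'.filter_mono nhdsWithin_le_nhds)))).exists
  have hc : q ∈ L.carrier := by
    rw [he q hq]
    rcases hs with rfl | rfl
    · exact Or.inl (by linarith)
    · exact Or.inr (by linarith)
  exact (hm hc).1 (h2.2 hxy) (h1.2 hxy)

lemma IsMirrorImage.overpass_iff {L L' : LinkDiagram S} (h : L.IsMirrorImage L') {p : S}
    (hp : p ∈ L.crossings) {e : DiskChart p} (he : e.IsCross L.carrier) :
    (∀ᶠ q in 𝓝 p, q ∈ L'.overpass p ↔ e.x q = e.y q) ↔
      ¬ ∀ᶠ q in 𝓝 p, q ∈ L.overpass p ↔ e.x q = e.y q := by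
  constructor
  · intro h' hL
    exact h.not_same_overpass hp he (Or.inl rfl) (by simpa using hL) (by simpa using h')
  · intro hL
    have hp' : p ∈ L'.crossings := by rwa [h.1]
    have he' : e.IsCross L'.carrier := by rwa [h.1]
    -- Each overpass is one of the two diagonals; if neither diagram had the first, both would have
    -- the second.
    refine (L'.overpass_spec p hp' e he').resolve_right fun h' => ?_
    exact h.not_same_overpass hp he (Or.inr rfl)
      (by simpa using (L.overpass_spec p hp e he).resolve_left hL) (by simpa using h')

variable {u : ℂ}

lemma crossingValue_mem (hu : IsPrimitiveRoot u 5) (L : LinkDiagram S) (σ : L.State)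
    (p : L.crossings) : L.crossingValue u σ p ∈ bracketSubring hu := by
  unfold crossingValue
  dsimp only
  split_ifs <;> exact crossingVariable_mem hu _ _ _ _

lemma uValue_mem [CompactSpace S] (hu : IsPrimitiveRoot u 5) (L : LinkDiagram S) :
    L.uValue u ∈ bracketSubring hu := by
  refine sum_mem fun σ _ => ?_
  unfold stateValue
  split_ifs
  · exact zero_mem _
  · exact mul_mem (prod_mem fun f _ => faceVariable_zpow_mem hu _ _)
      (prod_mem fun p _ => L.crossingValue_mem hu σ p)

lemma IsMirrorImage.uValue_eq_conj [CompactSpace S] (hu : IsPrimitiveRoot u 5)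
    {L L' : LinkDiagram S} (h : L.IsMirrorImage L') : L'.uValue u = conj (L.uValue u) := by
  obtain ⟨P, o, ho⟩ := L
  obtain ⟨P', o', ho'⟩ := L'
  -- The charts chosen in `crossingValue` depend only on the projection, so after this
  -- identification both diagrams are read in the same chart.
  obtain rfl : P' = P := h.1
  unfold uValue
  rw [map_sum]
  refine Finset.sum_congr rfl fun σ _ => ?_
  unfold stateValue
  split_ifs
  · simp
  · rw [map_mul, map_prod, map_prod]
    congr 1
    · refine Finset.prod_congr rfl fun f _ => ?_
      rw [map_zpow₀, conj_faceVariable hu]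
    · refine Finset.prod_congr rfl fun p _ => ?_
      have hc := (P'.exists_isCross p.1 p.2).choose_spec
      have hiff := h.overpass_iff p.2 hc
      unfold crossingValue
      dsimp only at hiff ⊢
      by_cases hL : ∀ᶠ q in 𝓝 p.1, q ∈ o p.1 ↔
          (P'.exists_isCross p.1 p.2).choose.x q = (P'.exists_isCross p.1 p.2).choose.y q
      · rw [if_neg (fun h' => hiff.1 h' hL), if_pos hL, conj_crossingVariable hu]
      -- Here the value for the original diagram is already turned once; conjugation turns it again,
      -- and the half turn is undone by symmetry.
      · rw [if_pos (hiff.2 hL), if_neg hL, conj_crossingVariable hu, crossingVariable_half_turn]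

end LinkDiagram

end Diagram

end UInvariant

theorem mainTheorem8 {S : Type*} [TopologicalSpace S] [T2Space S] [CompactSpace S]
    [ChartedSpace UInvariant.HalfPlane S] [HasGroupoid S UInvariant.orientedPL]
    (u : ℂ) (hu : IsPrimitiveRoot u 5)
    (L Lstar : UInvariant.LinkDiagram S) (hL : L.WellPlaced) (h : L.IsMirrorImage Lstar) :
    (∃! v : Fin 4 → ℤ, L.uValue u = UInvariant.bracket u (v 0) (v 1) (v 2) (v 3)) ∧
    (∀ a b c d : ℤ, L.uValue u = UInvariant.bracket u a b c d →
      Lstar.uValue u = UInvariant.bracket u d c b a) ∧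
    Lstar.uValue u = conj (L.uValue u) := by
  have hconj := h.uValue_eq_conj hu
  refine ⟨?_, fun a b c d habcd => ?_, hconj⟩
  · obtain ⟨a, b, c, d, habcd⟩ := L.uValue_mem hu
    exact ⟨![a, b, c, d], habcd, fun w hw => UInvariant.bracket_injective hu (hw.symm.trans habcd)⟩
  · rw [hconj, habcd, UInvariant.conj_bracket hu]
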